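/- Let $\mathbb A$ and $\mathbb B$ be countable structures in (possibly different) relational signatures, with domains $A$ and $B$. A structure is called $\omega$-categorical if its automorphism group is oligomorphic, i.e. has finitely many orbits on $n$-tuples for every $n\ge 1$. It has no algebraicity if, for every finite (possibly empty) tuple $y$ of its elements, every element whose orbit under the pointwise stabiliser of $y$ in the automorphism group is finite is an entry of $y$. The monoid $\operatorname{End}(\mathbb A)$ of endomorphisms of $\mathbb A$ carries the topology of pointwise convergence (the subspace topology from $A^A$, where $A$ is discrete); a topological isomorphism is a monoid isomorphism that is a homeomorphism. An existential positive (ep) formula is a formula $\exists x_1\cdots\exists x_n\,\varphi$ with $\varphi$ built from atomic formulas, $\top$ and $\bot$ by conjunction and disjunction; a relation is ep-definable if it is defined by an ep-formula without parameters. An ep-interpretation of $\mathbb B$ in $\mathbb A$ is a partial surjective map $\Gamma\colon A^n\to B$, $n\ge 1$, such that the preimage of every relation defined in $\mathbb B$ by an atomic formula (including equality) is ep-definable in $\mathbb A$. The structures $\mathbb A,\mathbb B$ are ep-bi-interpretable if there are ep-interpretations $\Gamma\colon A^n\to B$ of $\mathbb B$ in $\mathbb A$ and $\Delta\colon B^m\to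 A$ of $\mathbb A$ in $\mathbb B$ such that the graphs of the compositions $\Delta\circ\Gamma\colon A^{mn}\to A$ and $\Gamma\circ\Delta\colon B^{nm}\to B$ (the inner map being applied to each block of coordinates) are ep-definable in $\mathbb A$ and in $\mathbb B$, respectively. Proposition. Let $\mathbb A$ and $\mathbb B$ be $\omega$-categorical structures without algebraicity. Then every topological isomorphism $\operatorname{End}(\mathbb A)\to\operatorname{End}(\mathbb B)$ maps constant endomorphisms to constant endomorphisms. Moreover, $\operatorname{End}(\mathbb A)$ and $\operatorname{End}(\mathbb B)$ are topologically isomorphic if and only if $\mathbb A$ and $\mathbb B$ are ep-bi-interpretable. -/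

import Mathlib

open FirstOrder

namespace EPBiInt

section Symmetries

variable (L : FirstOrder.Language) (M : Type*) [L.Structure M]

/-- The endomorphisms `M →[L] M` of a structure form a monoid under composition
(`e * f` is the map `x ↦ e (f x)`). -/
instance endMonoid : Monoid (M →[L] M) where
  mul e f := e.comp f
  one := FirstOrder.Language.Hom.id L M
  mul_assoc _ _ _ := rfl
  one_mul _ := rfl
  mul_one _ := rfl

/-- The topology of pointwise convergence on the endomorphism monoid: the subspace topology
inherited from the product topology on `M → M`, where `M` is discrete. -/
instance endTopology : TopologicalSpace (M →[L] M) :=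
  TopologicalSpace.induced (fun e : M →[L] M => (e : M → M))
    (@Pi.topologicalSpace M (fun _ => M) (fun _ => ⊥))

/-- The automorphism group of a structure, as a permutation group on its domain. -/
def autGroup : Subgroup (Equiv.Perm M) where
  carrier := {σ | ∃ f : M ≃[L] M, f.toEquiv = σ}
  one_mem' := ⟨FirstOrder.Language.Equiv.refl L M, rfl⟩
  mul_mem' := by
    rintro _ _ ⟨f, rfl⟩ ⟨g, rfl⟩
    exact ⟨f.comp g, rfl⟩
  inv_mem' := by
    rintro _ ⟨f, rfl⟩
    exact ⟨f.symm, rfl⟩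

/-- An endomorphism is constant if it takes exactly one value. -/
def IsConstant {L : FirstOrder.Language} {M : Type*} [L.Structure M] (e : M →[L] M) : Prop :=
  ∃ c : M, ∀ x : M, e x = c

end Symmetries

section PermutationGroups

variable {Ω : Type*}

/-- A permutation group on `Ω` is oligomorphic if it has finitely many orbits on `Ωⁿ`, for every
`n ≥ 1`. -/
def IsOligomorphic (G : Subgroup (Equiv.Perm Ω)) : Prop :=
  ∀ n : ℕ, 1 ≤ n → Finite (MulAction.orbitRel.Quotient G (Fin n → Ω))

/-- A permutation group on `Ω` is without algebraicity if, for every finite tuple `y` (possibly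
empty), the only elements of `Ω` with a finite orbit under the pointwise stabiliser of `y` are the
entries of `y`. -/
def WithoutAlgebraicity (G : Subgroup (Equiv.Perm Ω)) : Prop :=
  ∀ (n : ℕ) (y : Fin n → Ω) (x : Ω),
    (MulAction.orbit (MulAction.stabilizer G y) x).Finite → x ∈ Set.range y

end PermutationGroups

/-- A structure is `ω`-categorical if its automorphism group is oligomorphic. -/
def OmegaCategorical (L : FirstOrder.Language) (M : Type*) [L.Structure M] : Prop :=
  IsOligomorphic (autGroup L M)

/-- A structure has no algebraicity if its automorphism group acts without algebraicity. -/
def NoAlgebraicity (L : FirstOrder.Language) (M : Type*) [L.Structure M] : Prop :=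
  WithoutAlgebraicity (autGroup L M)

section Formulas

variable {L : FirstOrder.Language} {α : Type*}

/-- Quantifier-free formulas without negations: those built from `⊥`, `⊤` and atomic formulas by
conjunction and disjunction. -/
inductive IsPositiveQF {n : ℕ} : L.BoundedFormula α n → Prop
  | bot : IsPositiveQF ⊥
  | top : IsPositiveQF ⊤
  | of_isAtomic {φ : L.BoundedFormula α n} (h : φ.IsAtomic) : IsPositiveQF φ
  | inf {φ ψ : L.BoundedFormula α n} (hφ : IsPositiveQF φ) (hψ : IsPositiveQF ψ) :
      IsPositiveQF (φ ⊓ ψ)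
  | sup {φ ψ : L.BoundedFormula α n} (hφ : IsPositiveQF φ) (hψ : IsPositiveQF ψ) :
      IsPositiveQF (φ ⊔ ψ)

/-- Existential positive formulas: `∃ x₁ ⋯ ∃ xₙ, φ` with `φ` quantifier-free without negations. -/
inductive IsEP : ∀ {n : ℕ}, L.BoundedFormula α n → Prop
  | of_isPositiveQF {n : ℕ} {φ : L.BoundedFormula α n} (h : IsPositiveQF φ) : IsEP φ
  | ex {n : ℕ} {φ : L.BoundedFormula α (n + 1)} (h : IsEP φ) : IsEP φ.ex

end Formulas

/-- A relation on `M`, with coordinates indexed by `ι`, is ep-definable in the structure `M` if it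
is the set of solutions of an existential positive formula (without parameters). -/
def EPDefinable (L : FirstOrder.Language) {M : Type*} [L.Structure M] {ι : Type}
    (S : Set (ι → M)) : Prop :=
  ∃ φ : L.Formula ι, IsEP φ ∧ S = {v | φ.Realize v}

/-- The coordinatewise extension of a partial map `Mⁿ ⇀ N` to a partial map `(Mⁿ)ᵏ ⇀ Nᵏ`, defined
on those `k`-tuples of `n`-tuples all of whose members lie in the domain. -/
def power {M N : Type*} {n : ℕ} (f : (Fin n → M) →. N) (k : ℕ) :
    (Fin k × Fin n → M) →. (Fin k → N) :=
  fun t => ⟨∀ i, (f fun j => t (i, j)).Dom, fun h i => (f fun j => t (i, j)).get (h i)⟩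

/-- An ep-interpretation of the structure `N` in the structure `M`: a partial surjective map
`Mⁿ ⇀ N`, with `n ≥ 1`, such that the preimages of all relations definable by atomic formulas over
`N` are ep-definable in `M`. (The formulas `x = x` and `x = y` account for the domain and the kernel
of the map.) -/
structure EPInterpretation (L : FirstOrder.Language) (M : Type*) [L.Structure M]
    (L' : FirstOrder.Language) (N : Type*) [L'.Structure N] where
  dim : ℕ
  one_le_dim : 1 ≤ dim
  map : (Fin dim → M) →. N
  surjective : ∀ y : N, ∃ x : Fin dim → M, y ∈ map x
  definable : ∀ (k : ℕ) (φ : L'.Formula (Fin k)), φ.IsAtomic →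
    EPDefinable L ((power map k).preimage {y | φ.Realize y})

/-- The composition `Δ ∘ Γ : (Mⁿ)ᵐ ⇀ P` of partial maps `Γ : Mⁿ ⇀ N` and `Δ : Nᵐ ⇀ P`. -/
def composition {M N P : Type*} {n m : ℕ} (Δ : (Fin m → N) →. P) (Γ : (Fin n → M) →. N) :
    (Fin m × Fin n → M) →. P :=
  Δ.comp (power Γ m)

/-- The graph of a partial map `M^ι ⇀ M`, as a relation on `M`; the last coordinate holds the
value. -/
def graphRel {M : Type*} {ι : Type} (f : (ι → M) →. M) : Set (ι ⊕ Unit → M) :=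
  {v | v (Sum.inr ()) ∈ f fun i => v (Sum.inl i)}

/-- Two structures are ep-bi-interpretable if there are ep-interpretations `Γ` of `N` in `M` and
`Δ` of `M` in `N` such that the graphs of `Δ ∘ Γ` and `Γ ∘ Δ` are ep-definable in `M` and `N`
respectively. -/
def EPBiInterpretable (L : FirstOrder.Language) (M : Type*) [L.Structure M]
    (L' : FirstOrder.Language) (N : Type*) [L'.Structure N] : Prop :=
  ∃ (Γ : EPInterpretation L M L' N) (Δ : EPInterpretation L' N L M),
    EPDefinable L (graphRel (composition Δ.map Γ.map)) ∧
      EPDefinable L' (graphRel (composition Γ.map Δ.map))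

end EPBiInt

/-!
# Topological isomorphisms of endomorphism monoids and ep-bi-interpretations

An ep-interpretation `Γ` of `B` in `A` turns endomorphisms of `A` into endomorphisms of `B`, because
existential positive formulas are preserved by homomorphisms; if the compositions of two
ep-interpretations have ep-definable graphs, the two induced homomorphisms are mutually inverse, and
they are visibly continuous (`EPBiInterpretable.nonempty_continuousMulEquiv`).

For the converse, let `φ` be a topological isomorphism. Three facts are needed.

* Over a countable `ω`-categorical structure every relation preserved by all endomorphisms is
  ep-definable (`epDefinable_of_preserved`). Hence it suffices to find partial surjections
  `Γ : Aⁿ ⇀ B` and `Δ : Bᵐ ⇀ A` that are equivariant with respect to `φ` and `φ⁻¹`: the preimages of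
  atomic relations and the graphs of the compositions are then preserved by endomorphisms.
* The map `φ` is uniformly continuous: `φ e b` depends only on the restriction of `e` to a finite
  set `S` (`exists_finset_determining`). So `e|S ↦ φ e b` is a well-defined equivariant map onto the
  orbit of `b`. Finitely many `b` generate `B`, and their orbits have to be put together.
* The map `φ` preserves constants (`IsConstant.map_mulEquiv`). Without algebraicity, an element
  fixed by the common stabiliser of two elements is one of the two, and this fails for the image of
  a constant if it takes two or more values. This makes the gluing possible: the maps belonging to
  different `b` are defined on different patterns of tuples, which coincide only after applying
  endomorphisms that are constant on `S`, where the values agree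
  (`exists_equivariant_surjection`).

The first two facts, and the fact that endomorphisms constant on a large finite set come from
constant endomorphisms (`exists_finset_constant`), rest on the same compactness argument: in an
`ω`-categorical structure, maps into `A` taken up to automorphisms of `A` converge along
ultrafilters (`exists_ultralimit`).
-/

open FirstOrder Filter

namespace EPBiInt

/-! ### The topology and the automorphisms -/

section Basic

variable {L : FirstOrder.Language} {M : Type*} [L.Structure M]

@[simp]
lemma mul_apply (e f : M →[L] M) (x : M) : (e * f) x = e (f x) := rfl

@[simp]
lemma one_apply (x : M) : (1 : M →[L] M) x = x := rfl

lemma toHom_symm_mul (σ : M ≃[L] M) : σ.symm.toHom * σ.toHom = 1 := by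
  ext x
  simp

/-- A map `φ` into an endomorphism monoid is continuous as soon as `f ↦ φ f y` is locally constant
for every `y`. -/
lemma continuous_of_locally_constant {X : Type*} [TopologicalSpace X] {φ : X → (M →[L] M)}
    (h : ∀ y f, ∀ᶠ g in nhds f, φ g y = φ f y) : Continuous φ := by
  let : TopologicalSpace M := ⊥
  have : DiscreteTopology M := ⟨rfl⟩
  refine continuous_induced_rng.2 (continuous_pi fun y => continuous_iff_continuousAt.2 fun f => ?_)
  rw [ContinuousAt, nhds_discrete M, tendsto_pure]
  exact h y f

lemma eventually_apply_eq (y : M) (f : M →[L] M) : ∀ᶠ g in nhds f, g y = f y := by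
  let : TopologicalSpace M := ⊥
  have : DiscreteTopology M := ⟨rfl⟩
  have h : Continuous fun g : M →[L] M => g y :=
    (continuous_apply y).comp continuous_induced_dom
  have := h.continuousAt (x := f)
  rwa [ContinuousAt, nhds_discrete M, tendsto_pure] at this

/-- The basic neighbourhoods of `f` consist of the endomorphisms agreeing with `f` on a finite
set. -/
lemma exists_finset_of_mem_nhds {f : M →[L] M} {s : Set (M →[L] M)} (hs : s ∈ nhds f) :
    ∃ S : Finset M, ∀ g : M →[L] M, (∀ x ∈ S, g x = f x) → g ∈ s := by
  let : TopologicalSpace M := ⊥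
  obtain ⟨u, hu, hus⟩ := (mem_nhds_induced _ _ _).1 hs
  obtain ⟨v, hvu, hv, hfv⟩ := mem_nhds_iff.1 hu
  obtain ⟨S, w, hw, hwv⟩ := isOpen_pi_iff.1 hv _ hfv
  refine ⟨S, fun g hg => hus (hvu (hwv fun x hx => ?_))⟩
  change g x ∈ w x
  rw [hg x hx]
  exact (hw x hx).2

lemma exists_orbit_representatives (h : OmegaCategorical L M) (ι : Type*) [Finite ι] :
    ∃ T : Set (ι → M), T.Finite ∧ ∀ x, ∃ σ : M ≃[L] M, σ ∘ x ∈ T := by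
  obtain ⟨n, ⟨e⟩⟩ := Finite.exists_equiv_fin ι
  rcases Nat.eq_zero_or_pos n with rfl | hn
  · have : IsEmpty ι := e.isEmpty
    exact ⟨Set.univ, Set.toFinite _, fun x => ⟨FirstOrder.Language.Equiv.refl L M, trivial⟩⟩
  · have := h n hn
    let r : MulAction.orbitRel.Quotient (autGroup L M) (Fin n → M) → ι → M :=
      fun q => q.out ∘ e
    refine ⟨Set.range r, Set.finite_range r, fun x => ?_⟩
    have hq : (MulAction.orbitRel (autGroup L M) (Fin n → M)).r
        (Quotient.mk (MulAction.orbitRel (autGroup L M) (Fin n → M)) (x ∘ e.symm)).out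
        (x ∘ e.symm) := Quotient.mk_out (x ∘ e.symm)
    obtain ⟨⟨_, σ, rfl⟩, hσ⟩ := hq
    refine ⟨σ, ⟨Quotient.mk _ (x ∘ e.symm), ?_⟩⟩
    funext i
    have := congrFun hσ (e i)
    simp only [r, Function.comp_apply]
    rw [← this]
    change σ (x (e.symm (e i))) = _
    simp

/-- Without algebraicity, an element outside a finite set can be moved by an automorphism that
fixes the finite set pointwise. -/
lemma exists_automorphism_moving (h : NoAlgebraicity L M) {S : Set M} (hS : S.Finite) {x : M}
    (hx : x ∉ S) : ∃ σ : M ≃[L] M, (∀ y ∈ S, σ y = y) ∧ σ x ≠ x := by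
  by_contra! hfix
  obtain ⟨n, y, -, rfl⟩ := hS.fin_param
  refine hx (h n y x ((Set.finite_singleton x).subset ?_))
  rintro _ ⟨⟨⟨_, σ, rfl⟩, hσ⟩, rfl⟩
  refine hfix σ ?_
  rintro _ ⟨i, rfl⟩
  exact congrFun hσ i

end Basic

/-! ### Constants are preserved -/

section Constants

variable {L : FirstOrder.Language} {A : Type*} [L.Structure A]
  {L' : FirstOrder.Language} {B : Type*} [L'.Structure B]

lemma nonempty_of_mulEquiv (hA : NoAlgebraicity L A) (φ : (A →[L] A) ≃* (B →[L'] B))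
    [Nonempty A] : Nonempty B := by
  by_contra hB
  rw [not_nonempty_iff] at hB
  obtain ⟨x⟩ := ‹Nonempty A›
  obtain ⟨σ, -, hσ⟩ := exists_automorphism_moving hA Set.finite_empty (Set.notMem_empty x)
  have h : σ.toHom = 1 := φ.injective (by ext y; exact isEmptyElim y)
  exact hσ (DFunLike.congr_fun h x)

/-- The image `z` of a constant endomorphism is a left zero of the monoid, so its range is finite.
If `z` took two values `p ≠ q`, choose automorphisms `σ`, `τ` that move `p`, respectively `q`, and
fix the rest of the range. Whatever fixes `σ z` and `τ z` fixes `z`; hence, on the other side, the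
constant `c` is fixed by everything that fixes two elements distinct from `c`. -/
theorem IsConstant.map_mulEquiv (hA : NoAlgebraicity L A) (hB : OmegaCategorical L' B)
    (hB' : NoAlgebraicity L' B) (φ : (A →[L] A) ≃* (B →[L'] B)) {e : A →[L] A}
    (he : IsConstant e) : IsConstant (φ e) := by
  obtain ⟨c, hc⟩ := he
  have : Nonempty A := ⟨c⟩
  obtain ⟨b₀⟩ := nonempty_of_mulEquiv hA φ
  have hzero : ∀ (g : B →[L'] B) (x : B), φ e (g x) = φ e x := by
    intro g x
    have : e * φ.symm g = e := by
      ext x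
      simp [hc]
    rw [← mul_apply, ← φ.apply_symm_apply g, ← map_mul, this]
  have hfin : (Set.range (φ e)).Finite := by
    obtain ⟨T, hT, hT'⟩ := exists_orbit_representatives hB Unit
    refine (hT.image fun t => φ e (t ())).subset ?_
    rintro _ ⟨x, rfl⟩
    obtain ⟨σ, hσ⟩ := hT' fun _ => x
    exact ⟨_, hσ, hzero σ.toHom x⟩
  by_contra hcon
  obtain ⟨q, hq, hqp⟩ : ∃ q ∈ Set.range (φ e), q ≠ φ e b₀ := by
    by_contra! h
    exact hcon ⟨_, fun x => h _ ⟨x, rfl⟩⟩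
  have hmove : ∀ p ∈ Set.range (φ e), ∃ σ : B ≃[L'] B,
      (∀ y ∈ Set.range (φ e), y ≠ p → σ y = y) ∧ φ.symm σ.toHom c ≠ c := by
    rintro _ ⟨x, rfl⟩
    obtain ⟨σ, hσ, hσp⟩ := exists_automorphism_moving hB' (S := Set.range (φ e) \ {φ e x})
      (x := φ e x) (hfin.subset Set.sdiff_subset) (by simp)
    refine ⟨σ, fun y hy hne => hσ y ⟨hy, hne⟩, fun hfix => hσp ?_⟩
    have : φ.symm σ.toHom * e = e := by
      ext y
      simp [hc, hfix]
    have := DFunLike.congr_fun (congrArg φ this) x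
    simpa using this
  obtain ⟨σ, hσ, hσc⟩ := hmove _ ⟨b₀, rfl⟩
  obtain ⟨τ, hτ, hτc⟩ := hmove q hq
  obtain ⟨ρ, hρ, hρc⟩ := exists_automorphism_moving hA
    (S := {φ.symm σ.toHom c, φ.symm τ.toHom c}) (x := c) (Set.toFinite _) (by
      rintro (h | h)
      exacts [hσc h.symm, hτc h.symm])
  have key : ∀ κ : B ≃[L'] B, ρ (φ.symm κ.toHom c) = φ.symm κ.toHom c →
      ∀ x, κ (φ e x) = φ e x → φ ρ.toHom (φ e x) = φ e x := by
    intro κ hκ x hx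
    have : ρ.toHom * (φ.symm κ.toHom * e) = φ.symm κ.toHom * e := by
      ext y
      simp [hc, hκ]
    have := DFunLike.congr_fun (congrArg φ this) x
    simpa [hx] using this
  have hρe : φ ρ.toHom * φ e = φ e := by
    ext x
    by_cases hx : φ e x = φ e b₀
    · exact key τ (hρ _ (by simp)) x (hτ _ ⟨x, rfl⟩ (by rw [hx]; exact hqp.symm))
    · exact key σ (hρ _ (by simp)) x (hσ _ ⟨x, rfl⟩ hx)
  rw [← map_mul] at hρe
  refine hρc ?_
  have := DFunLike.congr_fun (φ.injective hρe) c
  simpa [hc] using this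

end Constants

/-! ### Compactness modulo automorphisms -/

section Compactness

variable {L : FirstOrder.Language} {A : Type*} [L.Structure A]

/-- Sequences in `A`, taken up to automorphisms, form a compact space: along an ultrafilter, every
family of sequences converges up to left multiplication by automorphisms. -/
lemma exists_ultralimit_nat (hA : OmegaCategorical L A) {I : Type*} (U : Ultrafilter I)
    (F : I → ℕ → A) :
    ∃ f : ℕ → A, ∀ n, ∀ᶠ i in U, ∃ σ : A ≃[L] A, ∀ k < n, σ (F i k) = f k := by
  let P (n : ℕ) (g : ℕ → A) : Prop := ∀ᶠ i in U, ∃ σ : A ≃[L] A, ∀ k < n, σ (F i k) = g k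
  -- The orbit of the first `n + 1` entries is constant along `U`; a representative of it is chosen
  -- among the automorphic images of the given sequences.
  have step : ∀ n g, P n g → ∃ g', P (n + 1) g' ∧ ∀ k < n, g' k = g k := by
    intro n g hg
    obtain ⟨T, hT, hT'⟩ := exists_orbit_representatives hA (Fin (n + 1))
    have : ∀ᶠ i in U, ∃ t ∈ T, ∃ τ : A ≃[L] A, (fun k : Fin (n + 1) => τ (F i k)) = t :=
      Eventually.of_forall fun i => by
        obtain ⟨τ, hτ⟩ := hT' fun k => F i k
        exact ⟨_, hτ, τ, rfl⟩
    obtain ⟨t, -, ht⟩ := (Ultrafilter.eventually_exists_mem_iff hT).1 this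
    obtain ⟨i₀, ⟨σ₀, hσ₀⟩, τ₀, hτ₀⟩ := (hg.and ht).exists
    refine ⟨fun k => σ₀ (F i₀ k), ?_, hσ₀⟩
    filter_upwards [ht] with i hi
    obtain ⟨τ, hτ⟩ := hi
    refine ⟨σ₀.comp (τ₀.symm.comp τ), fun k hk => ?_⟩
    have h : τ (F i k) = τ₀ (F i₀ k) := congrFun (hτ.trans hτ₀.symm) ⟨k, hk⟩
    simp [h]
  choose! next hnext hagree using step
  have ⟨i₀, _⟩ := U.nonempty_of_mem univ_mem
  let g : ℕ → ℕ → A := fun n => Nat.rec (F i₀) (fun n g => next n g) n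
  have hg : ∀ n, P n (g n) := fun n => by
    induction n with
    | zero => exact Eventually.of_forall fun i => ⟨FirstOrder.Language.Equiv.refl L A, by simp⟩
    | succ n ih => exact hnext n _ ih
  have hstable : ∀ n k, k < n → g n k = g (k + 1) k := by
    intro n k hk
    induction n, hk using Nat.le_induction with
    | base => rfl
    | succ n hn ih => exact (hagree n (g n) (hg n) k hn).trans ih
  refine ⟨fun k => g (k + 1) k, fun n => ?_⟩
  filter_upwards [hg n] with i hi
  obtain ⟨σ, hσ⟩ := hi
  exact ⟨σ, fun k hk => (hσ k hk).trans (hstable n k hk)⟩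

lemma exists_ultralimit (hA : OmegaCategorical L A) {X : Type*} [Countable X] {I : Type*}
    (U : Ultrafilter I) (F : I → X → A) :
    ∃ f : X → A, ∀ S : Finset X, ∀ᶠ i in U, ∃ σ : A ≃[L] A, ∀ x ∈ S, σ (F i x) = f x := by
  rcases isEmpty_or_nonempty X with hX | hX
  · exact ⟨isEmptyElim, fun S =>
      Eventually.of_forall fun i => ⟨FirstOrder.Language.Equiv.refl L A, isEmptyElim⟩⟩
  obtain ⟨s, hs⟩ := exists_surjective_nat X
  obtain ⟨f, hf⟩ := exists_ultralimit_nat hA U fun i k => F i (s k)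
  refine ⟨fun x => f (Function.surjInv hs x), fun S => ?_⟩
  filter_upwards [hf (S.sup (Function.surjInv hs) + 1)] with i hi
  obtain ⟨σ, hσ⟩ := hi
  refine ⟨σ, fun x hx => ?_⟩
  rw [← hσ _ (Nat.lt_succ_of_le (Finset.le_sup hx)), Function.surjInv_eq hs]

/-- If `F S` preserves the relations among the elements of the finite set `S`, then, up to
automorphisms, the maps `F S` accumulate at an endomorphism. -/
lemma exists_limit_endomorphism [L.IsRelational] [Countable A] (hA : OmegaCategorical L A)
    (F : Finset A → A → A)
    (hF : ∀ (S : Finset A) (n : ℕ) (r : L.Relations n) (x : Fin n → A), (∀ i, x i ∈ S) →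
      FirstOrder.Language.Structure.RelMap r x →
        FirstOrder.Language.Structure.RelMap r (F S ∘ x)) :
    ∃ (U : Ultrafilter (Finset A)) (f : A →[L] A), ∀ S₀ : Finset A, ∀ᶠ S in U,
      S₀ ⊆ S ∧ ∃ σ : A ≃[L] A, ∀ x ∈ S₀, σ (F S x) = f x := by
  let U : Ultrafilter (Finset A) := Ultrafilter.of atTop
  obtain ⟨f, hf⟩ := exists_ultralimit hA U F
  have hU : ∀ S₀ : Finset A, ∀ᶠ S in U, S₀ ⊆ S := fun S₀ =>
    Ultrafilter.of_le atTop (eventually_ge_atTop S₀)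
  refine ⟨U, ⟨f, fun {n} g => isEmptyElim g, fun {n} r x hx => ?_⟩,
    fun S₀ => (hU S₀).and (hf S₀)⟩
  classical
  obtain ⟨S, hS, σ, hσ⟩ := ((hU (Finset.univ.image x)).and (hf (Finset.univ.image x))).exists
  have hmem : ∀ i, x i ∈ Finset.univ.image x := fun i =>
    Finset.mem_image_of_mem x (Finset.mem_univ i)
  have := (σ.map_rel r _).2 (hF S n r x (fun i => hS (hmem i)) hx)
  convert this using 1
  funext i
  exact (hσ _ (hmem i)).symm

/-- A continuous homomorphism between endomorphism monoids is uniformly continuous in the following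
sense. This is where compactness modulo automorphisms enters: two sequences of endomorphisms
agreeing on larger and larger finite sets accumulate, after multiplication by the same
automorphisms, at a common limit. -/
lemma exists_finset_determining [L.IsRelational] [Countable A] (hA : OmegaCategorical L A)
    {L' : FirstOrder.Language} {B : Type*} [L'.Structure B] (φ : (A →[L] A) →* (B →[L'] B))
    (hφ : Continuous φ) (b : B) :
    ∃ S : Finset A, ∀ e e' : A →[L] A, (∀ x ∈ S, e x = e' x) → φ e b = φ e' b := by
  by_contra! h
  choose e e' hee hne using h
  obtain ⟨U, f, hf⟩ := exists_limit_endomorphism hA (fun S => e S)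
    fun S n r x _ hx => (e S).map_rel r x hx
  obtain ⟨S₀, hS₀⟩ := exists_finset_of_mem_nhds
    (hφ.continuousAt.eventually (eventually_apply_eq b (φ f)))
  obtain ⟨S, hS, σ, hσ⟩ := (hf S₀).exists
  have h1 : φ (σ.toHom * e S) b = φ f b := hS₀ _ fun x hx => hσ x hx
  have h2 : φ (σ.toHom * e' S) b = φ f b := hS₀ _ fun x hx => by
    rw [← hσ x hx, hee S x (hS hx)]
    rfl
  refine hne S ?_
  have h3 := congrArg (φ σ.symm.toHom) (h1.trans h2.symm)
  simpa only [← mul_apply, ← map_mul, ← mul_assoc, toHom_symm_mul, one_mul] using h3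

/-- If `S` is a sufficiently large finite set, every endomorphism that is constant on `S` has the
value of a constant endomorphism there. -/
lemma exists_finset_constant [L.IsRelational] [Countable A] [Nonempty A]
    (hA : OmegaCategorical L A) :
    ∃ S : Finset A, ∀ (e : A →[L] A) (d : A), (∀ x ∈ S, e x = d) →
      ∃ e₀ : A →[L] A, ∀ x, e₀ x = d := by
  by_contra! h
  choose e d hed hne using h
  obtain ⟨U, f, hf⟩ := exists_limit_endomorphism hA (fun S => e S)
    fun S n r x _ hx => (e S).map_rel r x hx
  obtain ⟨x₀⟩ := ‹Nonempty A›
  classical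
  have hconst : ∀ x, f x = f x₀ := by
    intro x
    obtain ⟨S, hS, σ, hσ⟩ := (hf {x, x₀}).exists
    rw [← hσ x (by simp), ← hσ x₀ (by simp), hed S x (hS (by simp)), hed S x₀ (hS (by simp))]
  obtain ⟨S, hS, σ, hσ⟩ := (hf {x₀}).exists
  obtain ⟨x, hx⟩ := hne S (σ.symm.toHom * f)
  refine hx ?_
  have h0 := hσ x₀ (by simp)
  rw [hed S x₀ (hS (by simp))] at h0
  simp [hconst x, ← h0]

end Compactness

/-! ### Existential positive definability -/

section Definability

variable {L : FirstOrder.Language} {A : Type*} [L.Structure A] {α : Type*}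

lemma IsPositiveQF.relabel {β : Type*} {m n : ℕ} {φ : L.BoundedFormula α m} (h : IsPositiveQF φ)
    (g : α → β ⊕ Fin n) : IsPositiveQF (φ.relabel g) := by
  induction h with
  | bot => exact .bot
  | top => exact .top
  | of_isAtomic h => exact .of_isAtomic (h.relabel g)
  | inf _ _ h₁ h₂ => exact .inf h₁ h₂
  | sup _ _ h₁ h₂ => exact .sup h₁ h₂

lemma IsEP.exs {n : ℕ} {φ : L.BoundedFormula α n} (h : IsEP φ) : IsEP φ.exs := by
  induction n with
  | zero => exact h
  | succ n ih => exact ih h.ex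

lemma realize_hom_of_isAtomic {M N : Type*} [L.Structure M] [L.Structure N] (f : M →[L] N) {n : ℕ}
    {φ : L.BoundedFormula α n} (h : φ.IsAtomic) {v : α → M} {xs : Fin n → M}
    (hφ : φ.Realize v xs) : φ.Realize (f ∘ v) (f ∘ xs) := by
  cases h with
  | equal t₁ t₂ =>
    rw [FirstOrder.Language.BoundedFormula.realize_bdEqual] at hφ ⊢
    rw [← Sum.comp_elim, FirstOrder.Language.HomClass.realize_term,
      FirstOrder.Language.HomClass.realize_term, hφ]
  | rel R ts =>
    rw [FirstOrder.Language.BoundedFormula.realize_rel] at hφ ⊢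
    simp only [← Sum.comp_elim, FirstOrder.Language.HomClass.realize_term]
    exact f.map_rel R _ hφ

lemma realize_hom_of_isPositiveQF {M N : Type*} [L.Structure M] [L.Structure N] (f : M →[L] N)
    {n : ℕ} {φ : L.BoundedFormula α n} (h : IsPositiveQF φ) {v : α → M} {xs : Fin n → M}
    (hφ : φ.Realize v xs) : φ.Realize (f ∘ v) (f ∘ xs) := by
  induction h with
  | bot => exact hφ
  | top => simp
  | of_isAtomic h => exact realize_hom_of_isAtomic f h hφ
  | inf _ _ h₁ h₂ =>
    rw [FirstOrder.Language.BoundedFormula.realize_inf] at hφ ⊢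
    exact hφ.imp h₁ h₂
  | sup _ _ h₁ h₂ =>
    rw [FirstOrder.Language.BoundedFormula.realize_sup] at hφ ⊢
    exact hφ.imp h₁ h₂

lemma realize_hom_of_isEP {M N : Type*} [L.Structure M] [L.Structure N] (f : M →[L] N)
    {n : ℕ} {φ : L.BoundedFormula α n} (h : IsEP φ) {v : α → M} {xs : Fin n → M}
    (hφ : φ.Realize v xs) : φ.Realize (f ∘ v) (f ∘ xs) := by
  induction h with
  | of_isPositiveQF h => exact realize_hom_of_isPositiveQF f h hφ
  | ex _ ih =>
    rw [FirstOrder.Language.BoundedFormula.realize_ex] at hφ ⊢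
    obtain ⟨a, ha⟩ := hφ
    refine ⟨f a, ?_⟩
    rw [← Fin.comp_snoc]
    exact ih ha

lemma EPDefinable.comp_mem {ι : Type} {S : Set (ι → A)} (hS : EPDefinable L S) (f : A →[L] A)
    {v : ι → A} (hv : v ∈ S) : f ∘ v ∈ S := by
  obtain ⟨φ, hφ, rfl⟩ := hS
  have := realize_hom_of_isEP f hφ hv
  rwa [Subsingleton.elim (f ∘ (default : Fin 0 → A)) default] at this

/-- A relation on `M` is positively quantifier-free definable if it is the set of solutions of a
quantifier-free formula without negations. -/
def PositiveQFDefinable (L : FirstOrder.Language) {M : Type*} [L.Structure M] (S : Set (α → M)) :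
    Prop :=
  ∃ φ : L.Formula α, IsPositiveQF φ ∧ S = {v | φ.Realize v}

lemma PositiveQFDefinable.biUnion {β : Type*} {T : Set β} (hT : T.Finite) {D : β → Set (α → A)}
    (h : ∀ t ∈ T, PositiveQFDefinable L (D t)) : PositiveQFDefinable L (⋃ t ∈ T, D t) := by
  induction T, hT using Set.Finite.induction_on with
  | empty => exact ⟨⊥, .bot, by ext; simp⟩
  | insert _ _ ih =>
    obtain ⟨φ, hφ, hφD⟩ := h _ (Set.mem_insert _ _)
    obtain ⟨ψ, hψ, hψD⟩ := ih fun t ht => h t (Set.mem_insert_of_mem _ ht)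
    refine ⟨φ ⊔ ψ, hφ.sup hψ, ?_⟩
    rw [Set.biUnion_insert, hφD, hψD]
    ext
    simp

lemma PositiveQFDefinable.biInter {β : Type*} {T : Set β} (hT : T.Finite) {D : β → Set (α → A)}
    (h : ∀ t ∈ T, PositiveQFDefinable L (D t)) : PositiveQFDefinable L (⋂ t ∈ T, D t) := by
  induction T, hT using Set.Finite.induction_on with
  | empty => exact ⟨⊤, .top, by ext; simp⟩
  | insert _ _ ih =>
    obtain ⟨φ, hφ, hφD⟩ := h _ (Set.mem_insert _ _)
    obtain ⟨ψ, hψ, hψD⟩ := ih fun t ht => h t (Set.mem_insert_of_mem _ ht)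
    refine ⟨φ ⊓ ψ, hφ.inf hψ, ?_⟩
    rw [Set.biInter_insert, hφD, hψD]
    ext
    simp

lemma PositiveQFDefinable.comp_mem {S : Set (α → A)} (hS : PositiveQFDefinable L S)
    (f : A →[L] A) {v : α → A} (hv : v ∈ S) : f ∘ v ∈ S := by
  obtain ⟨φ, hφ, rfl⟩ := hS
  have := realize_hom_of_isPositiveQF f hφ hv
  rwa [Subsingleton.elim (f ∘ (default : Fin 0 → A)) default] at this

/-- Over an `ω`-categorical structure infinite conjunctions reduce to finite ones. -/
lemma PositiveQFDefinable.sInter [Finite α] (hA : OmegaCategorical L A) {C : Set (Set (α → A))}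
    (h : ∀ D ∈ C, PositiveQFDefinable L D) : PositiveQFDefinable L (⋂₀ C) := by
  obtain ⟨T, hT, hT'⟩ := exists_orbit_representatives hA α
  -- For each representative outside the intersection, one member of `C` that misses it suffices.
  have hchoose : ∀ t, ∃ D, t ∉ ⋂₀ C → D ∈ C ∧ t ∉ D := by
    intro t
    by_cases ht : t ∈ ⋂₀ C
    · exact ⟨∅, fun h => absurd ht h⟩
    · rw [Set.mem_sInter] at ht
      push Not at ht
      obtain ⟨D, hD, htD⟩ := ht
      exact ⟨D, fun _ => ⟨hD, htD⟩⟩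
  choose D hD using hchoose
  have : ⋂₀ C = ⋂ t ∈ T \ ⋂₀ C, D t := by
    refine subset_antisymm (fun v hv => Set.mem_iInter₂.2 fun t ht => hv _ (hD t ht.2).1)
      fun v hv => ?_
    obtain ⟨σ, hσ⟩ := hT' v
    by_contra hvC
    have hσv : σ ∘ v ∉ ⋂₀ C := fun hmem => hvC fun E hE => by
      have h' := (h E hE).comp_mem σ.symm.toHom (hmem E hE)
      have hcomp : σ.symm.toHom ∘ σ ∘ v = v := by
        funext i
        simp
      rwa [hcomp] at h'
    obtain ⟨hDC, hvD⟩ := hD _ hσv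
    exact hvD ((h _ hDC).comp_mem σ.toHom (Set.mem_iInter₂.1 hv _ ⟨hσ, hσv⟩))
  rw [this]
  exact biInter (hT.subset Set.sdiff_subset) fun t ht => h _ (hD t ht.2).1

lemma PositiveQFDefinable.exists_block {ι : Type} {κ : Type*} [Finite κ] {S : Set (ι ⊕ κ → A)}
    (hS : PositiveQFDefinable L S) : EPDefinable L {v | ∃ w : κ → A, Sum.elim v w ∈ S} := by
  obtain ⟨φ, hφ, rfl⟩ := hS
  refine ⟨φ.iExs κ, IsEP.exs (.of_isPositiveQF (hφ.relabel _)), ?_⟩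
  ext v
  simp

/-- The tuples satisfying all atomic formulas satisfied by `a`. -/
def atomicCone (L : FirstOrder.Language) {M : Type*} [L.Structure M] (a : α → M) : Set (α → M) :=
  {b | ∀ θ : L.Formula α, θ.IsAtomic → θ.Realize a → θ.Realize b}

lemma positiveQFDefinable_atomicCone [Finite α] (hA : OmegaCategorical L A) (a : α → A) :
    PositiveQFDefinable L (atomicCone L a) := by
  have : atomicCone L a =
      ⋂₀ {D | ∃ θ : L.Formula α, θ.IsAtomic ∧ θ.Realize a ∧ D = {b | θ.Realize b}} := by
    ext b
    constructor
    · rintro hb _ ⟨θ, hθ, hθa, rfl⟩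
      exact hb θ hθ hθa
    · exact fun hb θ hθ hθa => hb _ ⟨θ, hθ, hθa, rfl⟩
  rw [this]
  refine .sInter hA ?_
  rintro _ ⟨θ, hθ, -, rfl⟩
  exact ⟨θ, .of_isAtomic hθ, rfl⟩

lemma atomicCone_eq_of_eq {a b : α → A} (hb : b ∈ atomicCone L a) {i j : α} (h : a i = a j) :
    b i = b j := by
  have := hb ((FirstOrder.Language.Term.var i).equal (FirstOrder.Language.Term.var j))
    (.equal _ _) (by simpa [FirstOrder.Language.Formula.realize_equal] using h)
  simpa [FirstOrder.Language.Formula.realize_equal] using this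

lemma atomicCone_relMap {a b : α → A} (hb : b ∈ atomicCone L a) {n : ℕ} {r : L.Relations n}
    {x : Fin n → α} (h : FirstOrder.Language.Structure.RelMap r (a ∘ x)) :
    FirstOrder.Language.Structure.RelMap r (b ∘ x) := by
  have := hb (r.formula fun i => FirstOrder.Language.Term.var (x i)) (.rel _ _)
    (by rw [FirstOrder.Language.Formula.realize_rel]; exact h)
  rw [FirstOrder.Language.Formula.realize_rel] at this
  exact this

lemma self_mem_atomicCone (a : α → A) : a ∈ atomicCone L a := fun _ _ h => h

/-- If the relation `R` is preserved by all endomorphisms, then its membership is forced by the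
atomic formulas satisfied together with the elements of a suitable finite set `S`. Otherwise
partial homomorphisms leading out of `R` would accumulate at an endomorphism violating `R`. -/
lemma exists_finset_forcing [L.IsRelational] [Countable A] (hA : OmegaCategorical L A)
    {ι : Type} [Finite ι] {R T : Set (ι → A)} (hT : T.Finite) (hTR : T ⊆ R)
    (hR : ∀ (f : A →[L] A), ∀ v ∈ R, f ∘ v ∈ R) :
    ∃ S : Finset A, ∀ u ∈ T, ∀ b : ι ⊕ S → A,
      b ∈ atomicCone L (Sum.elim u (Subtype.val : S → A)) → b ∘ Sum.inl ∈ R := by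
  classical
  by_contra! h
  choose u hu b hb hbR using h
  obtain ⟨U, f, hf⟩ := exists_limit_endomorphism hA
    (fun S x => if hx : x ∈ S then b S (Sum.inr ⟨x, hx⟩) else x) (by
      intro S n r x hx hr
      have := atomicCone_relMap (hb S) (r := r) (x := fun i => Sum.inr ⟨x i, hx i⟩) hr
      convert this using 1
      funext i
      simp [hx i])
  obtain ⟨u₀, hu₀, hu₀U⟩ := (Ultrafilter.eventually_exists_mem_iff (f := U)
    (P := fun t S => u S = t) hT).1 (Eventually.of_forall fun S => ⟨u S, hu S, rfl⟩)
  cases nonempty_fintype ι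
  obtain ⟨S, ⟨hS, σ, hσ⟩, rfl⟩ := ((hf (Finset.univ.image u₀)).and hu₀U).exists
  refine hbR S ?_
  have hbS : b S ∘ Sum.inl = (σ.symm.toHom * f) ∘ u S := by
    funext i
    have hi : u S i ∈ Finset.univ.image (u S) := Finset.mem_image_of_mem _ (Finset.mem_univ i)
    have h1 := hσ _ hi
    rw [dif_pos (hS hi)] at h1
    have h2 : b S (Sum.inl i) = b S (Sum.inr ⟨u S i, hS hi⟩) := atomicCone_eq_of_eq (hb S) rfl
    simp [h2, ← h1]
  rw [hbS]
  exact hR _ _ (hTR (hu S))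

/-- Over a countable `ω`-categorical structure, the relations preserved by all endomorphisms are
ep-definable. -/
theorem epDefinable_of_preserved [L.IsRelational] [Countable A] (hA : OmegaCategorical L A)
    {ι : Type} [Finite ι] {R : Set (ι → A)} (hR : ∀ (f : A →[L] A), ∀ v ∈ R, f ∘ v ∈ R) :
    EPDefinable L R := by
  obtain ⟨T, hT, hT'⟩ := exists_orbit_representatives hA ι
  obtain ⟨S, hS⟩ := exists_finset_forcing hA (hT.subset Set.inter_subset_left)
    (Set.inter_subset_right : T ∩ R ⊆ R) hR
  have hdef := (PositiveQFDefinable.biUnion (hT.subset (Set.inter_subset_left (t := R))) fun u _ =>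
    positiveQFDefinable_atomicCone hA (Sum.elim u (Subtype.val : S → A))).exists_block
  convert hdef using 1
  ext v
  simp only [Set.mem_ofPred_eq, Set.mem_iUnion]
  constructor
  · intro hv
    obtain ⟨σ, hσ⟩ := hT' v
    refine ⟨fun x => σ.symm x, σ ∘ v, ⟨hσ, hR σ.toHom v hv⟩, ?_⟩
    have := (positiveQFDefinable_atomicCone hA
      (Sum.elim (σ ∘ v) (Subtype.val : S → A))).comp_mem σ.symm.toHom (self_mem_atomicCone _)
    convert this using 1
    funext i
    cases i <;> simp
  · rintro ⟨w, u, hu, hw⟩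
    exact hS u hu _ hw

end Definability

/-! ### From interpretations to homomorphisms -/

section Induced

variable {L : FirstOrder.Language} {A : Type*} [L.Structure A]
  {L' : FirstOrder.Language} {B : Type*} [L'.Structure B]

lemma mem_power {M N : Type*} {n k : ℕ} {Γ : (Fin n → M) →. N} {t : Fin k × Fin n → M}
    {y : Fin k → N} : y ∈ power Γ k t ↔ ∀ i, y i ∈ Γ fun j => t (i, j) := by
  constructor
  · rintro ⟨h, rfl⟩ i
    exact Part.get_mem (h i)
  · intro h
    exact ⟨fun i => Part.dom_iff_mem.2 ⟨_, h i⟩,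
      funext fun i => Part.get_eq_of_mem (h i) _⟩

lemma mem_composition {M N P : Type*} {n m : ℕ} {Δ : (Fin m → N) →. P} {Γ : (Fin n → M) →. N}
    {t : Fin m × Fin n → M} {z : P} :
    z ∈ composition Δ Γ t ↔ ∃ y : Fin m → N, (∀ i, y i ∈ Γ fun j => t (i, j)) ∧ z ∈ Δ y := by
  refine Part.mem_bind_iff.trans (exists_congr fun y => and_congr_left fun _ => ?_)
  exact mem_power

/-- `g` is induced on `N` by the map `f` on `M` through the partial map `Γ`. -/
def Induces {M N : Type*} {n : ℕ} (Γ : (Fin n → M) →. N) (f : M → M) (g : N → N) : Prop :=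
  ∀ x y, y ∈ Γ x → g y ∈ Γ (f ∘ x)

namespace EPInterpretation

variable (Γ : EPInterpretation L A L' B)

lemma eq_of_induces {f : A → A} {g g' : B → B} (h : Induces Γ.map f g) (h' : Induces Γ.map f g') :
    g = g' := by
  funext y
  obtain ⟨x, hx⟩ := Γ.surjective y
  exact Part.mem_unique (h x y hx) (h' x y hx)

lemma exists_realize (f : A →[L] A) {k : ℕ} {θ : L'.Formula (Fin k)} (hθ : θ.IsAtomic)
    {x : Fin k → Fin Γ.dim → A} {y : Fin k → B} (hxy : ∀ i, y i ∈ Γ.map (x i))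
    (hy : θ.Realize y) : ∃ y' : Fin k → B, θ.Realize y' ∧ ∀ i, y' i ∈ Γ.map (f ∘ x i) := by
  have h := (Γ.definable k θ hθ).comp_mem f (v := fun p => x p.1 p.2)
    ((PFun.mem_preimage _ _ _).2 ⟨y, hy, mem_power.2 hxy⟩)
  obtain ⟨y', hy', h'⟩ := (PFun.mem_preimage _ _ _).1 h
  exact ⟨y', hy', mem_power.1 h'⟩

lemma exists_induced [L'.IsRelational] (f : A →[L] A) :
    ∃ g : B →[L'] B, Induces Γ.map f g := by
  -- The equality formula shows that `f` respects the kernel of `Γ`.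
  have hker : ∀ y, ∃ y', ∀ x, y ∈ Γ.map x → y' ∈ Γ.map (f ∘ x) := by
    intro y
    obtain ⟨x₀, hx₀⟩ := Γ.surjective y
    have key : ∀ x, y ∈ Γ.map x →
        ∃ y' : Fin 2 → B, y' 0 = y' 1 ∧ y' 0 ∈ Γ.map (f ∘ x₀) ∧ y' 1 ∈ Γ.map (f ∘ x) := by
      intro x hx
      obtain ⟨y', hy', h⟩ := Γ.exists_realize f
        (θ := (FirstOrder.Language.Term.var 0).equal (FirstOrder.Language.Term.var 1))
        (.equal _ _) (x := ![x₀, x]) (y := ![y, y]) (Fin.forall_fin_two.2 ⟨hx₀, hx⟩)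
        (by simp [FirstOrder.Language.Formula.realize_equal])
      exact ⟨y', by simpa [FirstOrder.Language.Formula.realize_equal] using hy', h 0, h 1⟩
    obtain ⟨y₀, -, h₀, -⟩ := key x₀ hx₀
    refine ⟨y₀ 0, fun x hx => ?_⟩
    obtain ⟨y', heq, h, h'⟩ := key x hx
    rwa [Part.mem_unique h₀ h, heq]
  choose g hg using hker
  refine ⟨⟨g, fun {n} c => isEmptyElim c, fun {n} r y hr => ?_⟩, fun x y hy => hg y x hy⟩
  choose x hx using fun i => Γ.surjective (y i)
  obtain ⟨y', hy', h⟩ := Γ.exists_realize f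
    (θ := r.formula fun i => FirstOrder.Language.Term.var i) (.rel _ _) hx
    (by rw [FirstOrder.Language.Formula.realize_rel]; exact hr)
  rw [FirstOrder.Language.Formula.realize_rel] at hy'
  convert hy' using 1
  funext i
  exact Part.mem_unique (hg _ _ (hx i)) (h i)

/-- The endomorphism of the interpreted structure induced by an endomorphism of the interpreting
one. -/
noncomputable def induced [L'.IsRelational] (f : A →[L] A) : B →[L'] B :=
  (Γ.exists_induced f).choose

lemma induces_induced [L'.IsRelational] (f : A →[L] A) : Induces Γ.map f (Γ.induced f) :=
  (Γ.exists_induced f).choose_spec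

lemma induced_mul [L'.IsRelational] (f g : A →[L] A) :
    Γ.induced (f * g) = Γ.induced f * Γ.induced g :=
  DFunLike.coe_injective (Γ.eq_of_induces (Γ.induces_induced (f * g)) fun x y hy =>
    Γ.induces_induced f _ _ (Γ.induces_induced g x y hy))

lemma continuous_induced [L'.IsRelational] : Continuous (Γ.induced : (A →[L] A) → (B →[L'] B)) := by
  refine continuous_of_locally_constant fun y f => ?_
  obtain ⟨x, hx⟩ := Γ.surjective y
  filter_upwards [eventually_all.2 fun j => eventually_apply_eq (x j) f] with g hg
  have h := Γ.induces_induced g x y hx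
  rw [show g ∘ x = f ∘ x from funext hg] at h
  exact Part.mem_unique h (Γ.induces_induced f x y hx)

lemma induced_induced [L.IsRelational] [L'.IsRelational] (Δ : EPInterpretation L' B L A)
    (h : EPDefinable L (graphRel (composition Δ.map Γ.map))) (f : A →[L] A) :
    Δ.induced (Γ.induced f) = f := by
  ext c
  obtain ⟨y, hy⟩ := Δ.surjective c
  choose x hx using fun i => Γ.surjective (y i)
  have h₁ : f c ∈ composition Δ.map Γ.map fun p => f (x p.1 p.2) := by
    have hc : c ∈ composition Δ.map Γ.map fun p => x p.1 p.2 := mem_composition.2 ⟨y, hx, hy⟩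
    exact h.comp_mem f (v := Sum.elim (fun p => x p.1 p.2) fun _ => c) hc
  have h₂ : Δ.induced (Γ.induced f) c ∈ composition Δ.map Γ.map fun p => f (x p.1 p.2) :=
    mem_composition.2 ⟨Γ.induced f ∘ y, fun i => Γ.induces_induced f _ _ (hx i),
      Δ.induces_induced _ _ _ hy⟩
  exact Part.mem_unique h₂ h₁

end EPInterpretation

lemma EPBiInterpretable.nonempty_continuousMulEquiv [L.IsRelational] [L'.IsRelational]
    (h : EPBiInterpretable L A L' B) : Nonempty ((A →[L] A) ≃ₜ* (B →[L'] B)) := by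
  obtain ⟨Γ, Δ, hΔΓ, hΓΔ⟩ := h
  exact ⟨{
    toFun := Γ.induced
    invFun := Δ.induced
    left_inv := Γ.induced_induced Δ hΔΓ
    right_inv := Δ.induced_induced Γ hΓΔ
    map_mul' := Γ.induced_mul
    continuous_toFun := Γ.continuous_induced
    continuous_invFun := Δ.continuous_induced }⟩

end Induced

/-! ### From isomorphisms to interpretations -/

section Interpretation

variable {L : FirstOrder.Language} {A : Type*} [L.Structure A]
  {L' : FirstOrder.Language} {B : Type*} [L'.Structure B]

/-- Let `S` be a finite set such that the restriction of `e` to `S` determines the values of `φ e`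
on orbit representatives `b`, and such that endomorphisms constant on `S` take the value of a
constant endomorphism there. The representative `b` is coded by the pattern of `S`-blocks that
lists `S` in the block indexed by `b` and is constant in all other blocks; `Γ` sends the image under
`e` of this pattern to `φ e b`. Patterns for different representatives have a common image only
if the endomorphisms involved are constant on `S`, and then both values of `Γ` are that of one
constant endomorphism of `B`. -/
theorem exists_equivariant_surjection [L.IsRelational] [Countable A] [Nonempty A] [Nonempty B]
    (hA : OmegaCategorical L A) (hB : OmegaCategorical L' B)
    (φ : (A →[L] A) ≃ₜ* (B →[L'] B)) (hconst : ∀ e, IsConstant e → IsConstant (φ e)) :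
    ∃ (n : ℕ) (Γ : (Fin n → A) →. B), 1 ≤ n ∧ (∀ y, ∃ x, y ∈ Γ x) ∧
      ∀ f : A →[L] A, Induces Γ f (φ f) := by
  classical
  obtain ⟨T', hT', hrep'⟩ := exists_orbit_representatives hB Unit
  obtain ⟨T, hT⟩ := (hT'.image fun t => t ()).exists_finset_coe
  have hrep : ∀ y, ∃ b ∈ T, ∃ σ : B ≃[L'] B, σ b = y := by
    intro y
    obtain ⟨σ, hσ⟩ := hrep' fun _ => y
    refine ⟨σ y, ?_, σ.symm, by simp⟩
    rw [← Finset.mem_coe, hT]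
    exact ⟨_, hσ, rfl⟩
  choose D hD using exists_finset_determining hA φ.toMulEquiv.toMonoidHom
    φ.continuous_toFun
  obtain ⟨S', hS'⟩ := exists_finset_constant hA
  obtain ⟨s₀⟩ := ‹Nonempty A›
  let S : Finset A := insert s₀ (S' ∪ T.biUnion D)
  have hs₀ : s₀ ∈ S := Finset.mem_insert_self _ _
  have hSS' : S' ⊆ S := fun x hx => Finset.mem_insert_of_mem (Finset.mem_union_left _ hx)
  have hdet : ∀ b ∈ T, ∀ e e' : A →[L] A, (∀ x ∈ S, e x = e' x) → φ e b = φ e' b :=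
    fun b hb e e' h => hD b e e' fun x hx => h x
      (Finset.mem_insert_of_mem (Finset.mem_union_right _ (Finset.mem_biUnion.2 ⟨b, hb, hx⟩)))
  let ε := Fintype.equivFin (T × S)
  let p (b : B) : Fin (Fintype.card (T × S)) → A := fun i =>
    if ((ε.symm i).1 : B) = b then (ε.symm i).2 else s₀
  have hp : ∀ b (t : T) (s : S), p b (ε (t, s)) = if (t : B) = b then (s : A) else s₀ := by
    intro b t s
    simp [p]
  let G (x : Fin (Fintype.card (T × S)) → A) (y : B) : Prop :=
    ∃ e : A →[L] A, ∃ b ∈ T, x = e ∘ p b ∧ y = φ e b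
  have hG : ∀ x y y', G x y → G x y' → y = y' := by
    rintro x _ _ ⟨e, b, hb, rfl, rfl⟩ ⟨e', b', hb', h, rfl⟩
    have hpt : ∀ (t : T), ∀ s ∈ S,
        e (if (t : B) = b then s else s₀) = e' (if (t : B) = b' then s else s₀) := by
      intro t s hs
      have := congrFun h (ε (t, ⟨s, hs⟩))
      simpa only [Function.comp_apply, hp] using this
    by_cases hbb : b = b'
    · subst hbb
      exact hdet b hb e e' fun x hx => by simpa using hpt ⟨b, hb⟩ x hx
    · have h1 : ∀ x ∈ S, e x = e' s₀ := fun x hx => by simpa [hbb] using hpt ⟨b, hb⟩ x hx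
      have h2 : ∀ x ∈ S, e s₀ = e' x := fun x hx => by
        simpa [Ne.symm hbb] using hpt ⟨b', hb'⟩ x hx
      have h3 : ∀ x ∈ S, e' x = e' s₀ := fun x hx => (h2 x hx).symm.trans (h1 s₀ hs₀)
      obtain ⟨c, hc⟩ := hS' e (e' s₀) fun x hx => h1 x (hSS' hx)
      obtain ⟨d, hd⟩ := hconst c ⟨_, hc⟩
      rw [hdet b hb e c fun x hx => (h1 x hx).trans (hc x).symm,
        hdet b' hb' e' c fun x hx => (h3 x hx).trans (hc x).symm, hd, hd]
  let Γ : (Fin (Fintype.card (T × S)) → A) →. B := fun x => ⟨∃ y, G x y, fun h => h.choose⟩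
  have hΓ : ∀ x y, y ∈ Γ x ↔ G x y := by
    intro x y
    constructor
    · rintro ⟨h, rfl⟩
      exact h.choose_spec
    · intro h
      exact ⟨⟨y, h⟩, hG x _ _ (Exists.choose_spec ⟨y, h⟩) h⟩
  refine ⟨_, Γ, ?_, ?_, ?_⟩
  · obtain ⟨b, hb, -⟩ := hrep (Classical.arbitrary B)
    exact Fintype.card_pos_iff.2 ⟨⟨b, hb⟩, ⟨s₀, hs₀⟩⟩
  · intro y
    obtain ⟨b, hb, σ, hσ⟩ := hrep y
    exact ⟨_, (hΓ _ _).2 ⟨φ.symm σ.toHom, b, hb, rfl, by simp [hσ]⟩⟩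
  · rintro f x y hy
    obtain ⟨e, b, hb, rfl, rfl⟩ := (hΓ _ _).1 hy
    exact (hΓ _ _).2 ⟨f * e, b, hb, rfl, by simp⟩

/-- The statement of `exists_equivariant_surjection` without the assumption that the structures are
nonempty. -/
lemma exists_equivariant_surjection' [L.IsRelational] [Countable A]
    (hA : OmegaCategorical L A) (hA' : NoAlgebraicity L A) (hB : OmegaCategorical L' B)
    (hB' : NoAlgebraicity L' B) (φ : (A →[L] A) ≃ₜ* (B →[L'] B)) :
    ∃ (n : ℕ) (Γ : (Fin n → A) →. B), 1 ≤ n ∧ (∀ y, ∃ x, y ∈ Γ x) ∧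
      ∀ f : A →[L] A, Induces Γ f (φ f) := by
  rcases isEmpty_or_nonempty B with hBe | hBe
  · exact ⟨1, fun _ => Part.none, le_rfl, isEmptyElim, fun f x y => isEmptyElim y⟩
  · have := nonempty_of_mulEquiv hB' φ.symm.toMulEquiv
    exact exists_equivariant_surjection hA hB φ fun e he =>
      he.map_mulEquiv hA' hB hB' φ.toMulEquiv

/-- An equivariant partial surjection is an ep-interpretation, since the preimages of atomic
relations are preserved by all endomorphisms. -/
def EPInterpretation.ofEquivariant [L.IsRelational] [Countable A] (hA : OmegaCategorical L A)
    (φ : (A →[L] A) → (B →[L'] B)) {n : ℕ} (Γ : (Fin n → A) →. B) (hn : 1 ≤ n)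
    (hsurj : ∀ y, ∃ x, y ∈ Γ x) (hΓ : ∀ f : A →[L] A, Induces Γ f (φ f)) :
    EPInterpretation L A L' B where
  dim := n
  one_le_dim := hn
  map := Γ
  surjective := hsurj
  definable k θ hθ := epDefinable_of_preserved hA <| by
    rintro f v ⟨y, hy, hv⟩
    refine (PFun.mem_preimage _ _ _).2
      ⟨φ f ∘ y, ?_, mem_power.2 fun i => hΓ f _ _ (mem_power.1 hv i)⟩
    have := realize_hom_of_isAtomic (φ f) hθ hy
    rwa [Subsingleton.elim (φ f ∘ (default : Fin 0 → B)) default] at this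

lemma epDefinable_graphRel_composition [L.IsRelational] [Countable A]
    (hA : OmegaCategorical L A) (φ : (A →[L] A) ≃ (B →[L'] B)) {n m : ℕ} {Γ : (Fin n → A) →. B}
    {Δ : (Fin m → B) →. A} (hΓ : ∀ f : A →[L] A, Induces Γ f (φ f))
    (hΔ : ∀ g : B →[L'] B, Induces Δ g (φ.symm g)) :
    EPDefinable L (graphRel (composition Δ Γ)) := by
  refine epDefinable_of_preserved hA fun f v hv => ?_
  obtain ⟨y, hy, hv⟩ := mem_composition.1 hv
  refine mem_composition.2 ⟨φ f ∘ y, fun i => hΓ f _ _ (hy i), ?_⟩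
  have := hΔ (φ f) _ _ hv
  rwa [φ.symm_apply_apply] at this

end Interpretation

end EPBiInt

theorem mainTheorem6
    (L : FirstOrder.Language) [L.IsRelational] (A : Type*) [L.Structure A] [Countable A]
    (L' : FirstOrder.Language) [L'.IsRelational] (B : Type*) [L'.Structure B] [Countable B]
    (hA : EPBiInt.OmegaCategorical L A) (hA' : EPBiInt.NoAlgebraicity L A)
    (hB : EPBiInt.OmegaCategorical L' B) (hB' : EPBiInt.NoAlgebraicity L' B) :
    (∀ φ : (A →[L] A) ≃ₜ* (B →[L'] B), ∀ e : A →[L] A,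
      EPBiInt.IsConstant e → EPBiInt.IsConstant (φ e)) ∧
    (Nonempty ((A →[L] A) ≃ₜ* (B →[L'] B)) ↔ EPBiInt.EPBiInterpretable L A L' B) := by
  refine ⟨fun φ e he => he.map_mulEquiv hA' hB hB' φ.toMulEquiv, ?_,
    EPBiInt.EPBiInterpretable.nonempty_continuousMulEquiv⟩
  rintro ⟨φ⟩
  obtain ⟨n, Γ, hn, hsurj, hΓ⟩ := EPBiInt.exists_equivariant_surjection' hA hA' hB hB' φ
  obtain ⟨m, Δ, hm, hsurj', hΔ⟩ := EPBiInt.exists_equivariant_surjection' hB hB' hA hA' φ.symm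
  exact ⟨.ofEquivariant hA φ Γ hn hsurj hΓ, .ofEquivariant hB φ.symm Δ hm hsurj' hΔ,
    EPBiInt.epDefinable_graphRel_composition hA φ.toEquiv hΓ hΔ,
    EPBiInt.epDefinable_graphRel_composition hB φ.symm.toEquiv hΔ hΓ⟩
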